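/- A loop is a set with a binary operation that has a two-sided identity element $1$ and in which the equations $ax=b$ and $ya=b$ have unique solutions for all $a,b$. A (right) Bol loop is a loop satisfying $x((yz)y)=((xy)z)y$; it has exponent two if $xx=1$ for all $x$. Let $B(X)$, with multiplication $\circ$, be a free Bol loop of exponent two with free set of generators $X$: $B(X)$ is a Bol loop of exponent two generated as a loop by the subset $X$, and every mapping from $X$ to a Bol loop $L$ of exponent two extends to a homomorphism $B(X)\to L$. Then for all $x,z\in B(X)\setminus\{1\}$ one has $z=x\circ(x\circ z)$ if and only if $x=z$. If moreover $|X|\neq 1$, then the left, middle and right nuclei $$N_\lambda=\{a: a\circ(x\circ y)=(a\circ x)\circ y\ \ \forall x,y\},\quad N_\mu=\{a: x\circ(a\circ y)=(x\circ a)\circ y\ \ \forall x,y\},\quad N_\rho=\{a: x\circ(y\circ a)=(x\circ y)\circ a\ \ \forall x,y\}$$ of $B(X)$ are all equal to $\{1\}$; hence the nucleus $N=N_\lambda\cap N_\mu\cap N_\rho$ and the center $\{a\in N: a\circ x=x\circ a\ \ \forall x\}$ are equal to $\{1\}$ as well. -/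

import Mathlib

universe u

/-- A loop: a set with a binary operation and a two-sided identity element in which the equations
`a * x = b` and `y * a = b` have unique solutions. -/
class Loop (L : Type u) extends MulOneClass L where
  existsUnique_left : ∀ a b : L, ∃! x : L, a * x = b
  existsUnique_right : ∀ a b : L, ∃! y : L, y * a = b

namespace Loop

/-- The (right) Bol identity. -/
def IsBol (L : Type u) [Loop L] : Prop :=
  ∀ x y z : L, x * ((y * z) * y) = ((x * y) * z) * y

/-- Exponent two, i.e. the identity `x * x = 1`. -/
def HasExponentTwo (L : Type u) [Loop L] : Prop :=
  ∀ x : L, x * x = 1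

/-- A subloop: a subset that contains `1` and is closed under multiplication and under solving the
equations `a * x = b` and `y * a = b`. -/
structure IsSubloop {L : Type u} [Loop L] (S : Set L) : Prop where
  one_mem : (1 : L) ∈ S
  mul_mem : ∀ a ∈ S, ∀ b ∈ S, a * b ∈ S
  left_mem : ∀ a ∈ S, ∀ x : L, a * x ∈ S → x ∈ S
  right_mem : ∀ a ∈ S, ∀ y : L, y * a ∈ S → y ∈ S

/-- The subset `X` generates the loop `L`: the only subloop that contains `X` is `L` itself. -/
def Generates {L : Type u} [Loop L] (X : Set L) : Prop :=
  ∀ S : Set L, IsSubloop S → X ⊆ S → S = Set.univ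

/-- `B` is a free Bol loop of exponent two with free set of generators `X ⊆ B`: it is a Bol loop
of exponent two, it is generated by `X`, and every mapping from `X` to a Bol loop `L` of exponent
two extends to a homomorphism from `B` to `L`. -/
structure IsFreeBolLoopTwo {B : Type u} [Loop B] (X : Set B) : Prop where
  isBol : IsBol B
  hasExponentTwo : HasExponentTwo B
  generates : Generates X
  exists_extension : ∀ (L : Type u) [Loop L], IsBol L → HasExponentTwo L →
    ∀ f : X → L, ∃ φ : B →* L, ∀ x : X, φ (x : B) = f x

/-- The left nucleus. -/
def leftNucleus (L : Type u) [Loop L] : Set L :=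
  {a | ∀ x y : L, a * (x * y) = (a * x) * y}

/-- The middle nucleus. -/
def middleNucleus (L : Type u) [Loop L] : Set L :=
  {a | ∀ x y : L, x * (a * y) = (x * a) * y}

/-- The right nucleus. -/
def rightNucleus (L : Type u) [Loop L] : Set L :=
  {a | ∀ x y : L, x * (y * a) = (x * y) * a}

/-- The nucleus. -/
def nucleus (L : Type u) [Loop L] : Set L :=
  leftNucleus L ∩ middleNucleus L ∩ rightNucleus L

/-- The center. -/
def center (L : Type u) [Loop L] : Set L :=
  {a | a ∈ nucleus L ∧ ∀ x : L, a * x = x * a}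

/-! The free Bol loop of exponent two on a type `X` exists: nonassociative words modulo the
congruence generated by the identities of the variety. -/

/-- Nonassociative words, with a symbol for the identity element. -/
inductive Word (X : Type u) : Type u
  | var : X → Word X
  | one : Word X
  | mul : Word X → Word X → Word X

/-- The congruence on words that is generated by the identities of Bol loops of exponent two. -/
inductive Word.Rel {X : Type u} : Word X → Word X → Prop
  | refl (a) : Rel a a
  | symm {a b} : Rel a b → Rel b a
  | trans {a b c} : Rel a b → Rel b c → Rel a c
  | mul {a b c d} : Rel a b → Rel c d → Rel (.mul a c) (.mul b d)
  | one_mul (a) : Rel (.mul .one a) a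
  | mul_one (a) : Rel (.mul a .one) a
  | mul_self (a) : Rel (.mul a a) .one
  | bol (x y z) : Rel (.mul x (.mul (.mul y z) y)) (.mul (.mul (.mul x y) z) y)

/-- Words up to the congruence. -/
def wordSetoid (X : Type u) : Setoid (Word X) :=
  ⟨Word.Rel, Word.Rel.refl, Word.Rel.symm, Word.Rel.trans⟩

/-- The free Bol loop of exponent two on the type `X`. -/
def FreeBolTwo (X : Type u) : Type u := Quotient (wordSetoid X)

namespace FreeBolTwo

/-- The canonical generators. -/
def of {X : Type u} (x : X) : FreeBolTwo X := Quotient.mk (wordSetoid X) (.var x)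

instance instMulOneClass (X : Type u) : MulOneClass (FreeBolTwo X) where
  one := Quotient.mk (wordSetoid X) .one
  mul := Quotient.map₂ Word.mul fun _ _ h _ _ h' => Word.Rel.mul h h'
  one_mul a := Quotient.inductionOn a fun a => Quotient.sound (s := wordSetoid X) (.one_mul a)
  mul_one a := Quotient.inductionOn a fun a => Quotient.sound (s := wordSetoid X) (.mul_one a)

theorem mul_self {X : Type u} (a : FreeBolTwo X) : a * a = 1 :=
  Quotient.inductionOn a fun a => Quotient.sound (s := wordSetoid X) (.mul_self a)

theorem bol {X : Type u} (x y z : FreeBolTwo X) : x * ((y * z) * y) = ((x * y) * z) * y :=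
  Quotient.inductionOn₃ x y z fun x y z => Quotient.sound (s := wordSetoid X) (.bol x y z)

theorem mul_mul_self {X : Type u} (x y : FreeBolTwo X) : (x * y) * y = x := by
  have h := bol x y 1
  rw [mul_one, mul_one, mul_self, mul_one] at h
  exact h.symm

instance instLoop (X : Type u) : Loop (FreeBolTwo X) where
  existsUnique_left a b := by
    refine ⟨(a * (b * a)) * a, ?_, ?_⟩
    · change a * ((a * (b * a)) * a) = b
      rw [bol, mul_self, one_mul, mul_mul_self]
    · rintro y rfl
      rw [bol, mul_self, one_mul, mul_mul_self]
  existsUnique_right a b := by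
    refine ⟨b * a, mul_mul_self b a, ?_⟩
    rintro y rfl
    exact (mul_mul_self y a).symm

/-- Evaluation of words in a loop. -/
def eval {X L : Type u} [Loop L] (f : X → L) : Word X → L
  | .var x => f x
  | .one => 1
  | .mul a b => eval f a * eval f b

theorem eval_rel {X L : Type u} [Loop L] (hb : IsBol L) (he : HasExponentTwo L) (f : X → L)
    {a b : Word X} (h : Word.Rel a b) : eval f a = eval f b := by
  induction h with
  | refl a => rfl
  | symm _ ih => exact ih.symm
  | trans _ _ ih₁ ih₂ => exact ih₁.trans ih₂
  | mul _ _ ih₁ ih₂ => simp only [eval, ih₁, ih₂]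
  | one_mul a => simp only [eval, _root_.one_mul]
  | mul_one a => simp only [eval, _root_.mul_one]
  | mul_self a => exact he _
  | bol x y z => exact hb _ _ _

/-- The homomorphism that extends a mapping of the generators. -/
def lift {X L : Type u} [Loop L] (hb : IsBol L) (he : HasExponentTwo L) (f : X → L) :
    FreeBolTwo X →* L where
  toFun := Quotient.lift (eval f) fun _ _ h => eval_rel hb he f h
  map_one' := rfl
  map_mul' a b := Quotient.inductionOn₂ a b fun _ _ => rfl

theorem of_injective (X : Type u) : Function.Injective (of : X → FreeBolTwo X) := by
  classical
  let A := Multiplicative (X → ZMod 2)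
  let _ : Loop A :=
    { existsUnique_left := fun a b =>
        ⟨a⁻¹ * b, mul_inv_cancel_left a b, fun _ h => eq_inv_mul_of_mul_eq h⟩
      existsUnique_right := fun a b =>
        ⟨b * a⁻¹, inv_mul_cancel_right b a, fun _ h => eq_mul_inv_of_mul_eq h⟩ }
  have hb : IsBol A := fun x y z => by
    change x * (y * z * y) = x * y * z * y
    simp only [mul_assoc]
  have he : HasExponentTwo A := fun x => by
    apply Multiplicative.toAdd.injective
    funext i
    exact CharTwo.add_self_eq_zero _
  intro x y h
  have h' := congrArg (lift hb he fun x : X => (Multiplicative.ofAdd (Pi.single x 1) : A)) h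
  have h'' : (Pi.single x 1 : X → ZMod 2) = Pi.single y 1 := Multiplicative.ofAdd.injective h'
  by_contra hxy
  have := congrFun h'' x
  simp [hxy] at this

theorem isFreeBolLoopTwo (X : Type u) :
    IsFreeBolLoopTwo (Set.range (of : X → FreeBolTwo X)) where
  isBol := bol
  hasExponentTwo := mul_self
  generates S hS hX := by
    refine Set.eq_univ_of_forall fun a => Quotient.inductionOn a fun w => ?_
    induction w with
    | var x => exact hX ⟨x, rfl⟩
    | one => exact hS.one_mem
    | mul a b iha ihb => exact hS.mul_mem _ iha _ ihb
  exists_extension L _ hb he f := by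
    refine ⟨lift hb he fun x => f ⟨of x, x, rfl⟩, ?_⟩
    rintro ⟨_, x, rfl⟩
    rfl

end FreeBolTwo

end Loop

-- In a Bol loop of exponent two the right translations are involutions and `R_((yz)y) = R_y R_z
-- R_y`. Conversely, let a group act on a pointed set so that every point is the image of the base
-- point under exactly one element of order at most two. Letting `p * q` be the image of `p` under
-- the element that belongs to `q` gives such a loop.
--
-- The group used here is generated by letters of order two acting on normal forms. A letter is
-- prepended or cancelled, except that a special letter exchanges the empty word with its base. A
-- letter becomes special only if no word in smaller letters already makes this exchange. Hence
-- every point can be exchanged with the empty word (`exists_swap_nil`), yet a nonempty reduced word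
-- never fixes two points (`not_two_fixed`). Elements of order at most two are therefore trivial, or
-- conjugates of letters and given only by words of odd length (`eq_one_or_conj`). They are
-- determined by the image of one point (`act_eq_act`).
--
-- If `z = x(xz)` and `w = xz`, then `(wz)w = z`, so `R_z R_w` has order at most two. For nontrivial
-- `z` and `w` it has even length, so it is trivial; then `z = w` and `x = wz = 1`. If `w = 1`, then
-- `x = z`. Evaluation of normal forms has a section over any free loop, which inherits the law. A
-- nontrivial nuclear element satisfies such an equation with every nontrivial element, hence equals
-- all of them, and there is only one generator.

namespace Loop

/-- Letters of a free product of groups of order two: one letter for every element of `X`, and one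
for every list of letters. -/
inductive Letter (X : Type u) : Type u
  | gen : X → Letter X
  | link : List (Letter X) → Letter X

-- Normal forms and the greedy choice of special letters

namespace Letter

variable {X : Type u}

/-- A well-order of the letters that extends the order by size. -/
noncomputable instance instLinearOrder : LinearOrder (Letter X) :=
  IsWellFounded.wellOrderExtension (InvImage (· < ·) (sizeOf : Letter X → ℕ))

instance instWellFoundedLT : WellFoundedLT (Letter X) :=
  IsWellFounded.wellOrderExtension.isWellFounded_lt (InvImage (· < ·) (sizeOf : Letter X → ℕ))

/-- The word that a letter links to the empty word. -/
def base : Letter X → List (Letter X)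
  | gen _ => []
  | link u => u

theorem lt_of_mem_base {i t : Letter X} (h : t ∈ base i) : t < i := by
  cases i with
  | gen x => simp [base] at h
  | link v =>
    have : sizeOf t < sizeOf (link v) := by
      have := List.sizeOf_lt_of_mem (show t ∈ v from h)
      simp only [link.sizeOf_spec]
      omega
    -- The extended order compares ranks first, so a smaller size suffices.
    exact Prod.Lex.left _ _ (IsWellFounded.rank_lt_of_rel (r := InvImage (· < ·) sizeOf) this)

open Classical in
/-- The action of a letter on words, where the letters in `D` exchange the empty word and their
base. -/
noncomputable def step (D : Letter X → Prop) (j : Letter X) (p : List (Letter X)) :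
    List (Letter X) :=
  if p.head? = some j then p.tail
  else if D j ∧ p = [] then base j
  else if D j ∧ p = base j then []
  else j :: p

/-- Normal forms of words. -/
inductive Valid (D : Letter X → Prop) : List (Letter X) → Prop
  | nil : Valid D []
  | cons {j p} : Valid D p → step D j p = j :: p → Valid D (j :: p)

/-- The action of a word, whose last letter acts first. -/
noncomputable def run (D : Letter X → Prop) (w p : List (Letter X)) : List (Letter X) :=
  w.foldr (step D) p

theorem step_congr {D E : Letter X → Prop} {j : Letter X} (h : D j ↔ E j) : step D j = step E j := by
  funext p
  by_cases hE : E j <;> simp [step, h, hE]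

theorem Valid.congr {D E : Letter X → Prop} {p : List (Letter X)} (hp : Valid D p)
    (h : ∀ j ∈ p, (D j ↔ E j)) : Valid E p := by
  induction hp with
  | nil => exact .nil
  | @cons j p _ hs ih =>
    refine .cons (ih fun k hk => h k (List.mem_cons_of_mem _ hk)) ?_
    rw [← step_congr (h j List.mem_cons_self), hs]

theorem run_congr {D E : Letter X → Prop} {w : List (Letter X)} (h : ∀ j ∈ w, (D j ↔ E j))
    (p : List (Letter X)) : run D w p = run E w p := by
  induction w with
  | nil => rfl
  | cons j w ih =>
    simp only [run, List.foldr_cons] at ih ⊢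
    rw [ih fun k hk => h k (List.mem_cons_of_mem _ hk), step_congr (h j List.mem_cons_self)]

/-- The condition under which a letter has to link the empty word to its base. -/
def Links (D : Letter X → Prop) (i : Letter X) : Prop :=
  base i ≠ [] ∧ Valid D (base i) ∧
    ¬ ∃ w : List (Letter X), (∀ j ∈ w, j < i) ∧ run D w [] = base i ∧ run D w (base i) = []

/-- Only values of `D` below `i` matter, since the base and the competing words use smaller letters.
This lets `Special` be defined by recursion. -/
theorem Links.congr {D E : Letter X → Prop} {i : Letter X} (h : ∀ j < i, (D j ↔ E j))
    (hi : Links D i) : Links E i := by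
  refine ⟨hi.1, hi.2.1.congr fun j hj => h j (lt_of_mem_base hj), ?_⟩
  rintro ⟨w, hw, h1, h2⟩
  refine hi.2.2 ⟨w, hw, ?_, ?_⟩
  · rw [run_congr fun j hj => h j (hw j hj), h1]
  · rw [run_congr fun j hj => h j (hw j hj), h2]

/-- The letters that link the empty word to their base, chosen greedily along the well-order. -/
def Special : Letter X → Prop :=
  wellFounded_lt.fix fun i rec => Links (fun j => ∃ h : j < i, rec j h) i

theorem special_iff (i : Letter X) : Special i ↔ Links Special i := by
  rw [Special, WellFounded.fix_eq]
  constructor <;> intro h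
  · exact h.congr fun j hj => ⟨fun ⟨_, h⟩ => h, fun h => ⟨hj, h⟩⟩
  · exact h.congr fun j hj => ⟨fun h => ⟨hj, h⟩, fun ⟨_, h⟩ => h⟩

variable {j : Letter X} {p : List (Letter X)}

theorem not_mem_base_self (j : Letter X) : j ∉ base j := fun h => lt_irrefl _ (lt_of_mem_base h)

theorem step_cons_self (j : Letter X) (p : List (Letter X)) : step Special j (j :: p) = p := by
  simp [step]

theorem step_nil (h : Special j) : step Special j [] = base j := by
  simp [step, h]

theorem head?_base_ne (j : Letter X) : (base j).head? ≠ some j := fun h =>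
  not_mem_base_self j (List.mem_of_head? h)

theorem step_base (h : Special j) : step Special j (base j) = [] := by
  have h0 := ((special_iff j).1 h).1
  simp [step, h, h0, head?_base_ne]

theorem step_eq_cons (h : p.head? ≠ some j) (h' : ¬ (Special j ∧ (p = [] ∨ p = base j))) :
    step Special j p = j :: p := by
  have h1 : ¬ (Special j ∧ p = []) := fun h => h' ⟨h.1, .inl h.2⟩
  have h2 : ¬ (Special j ∧ p = base j) := fun h => h' ⟨h.1, .inr h.2⟩
  rw [step, if_neg h, if_neg h1, if_neg h2]

theorem Valid.step_eq_cons (h : Valid Special (j :: p)) : step Special j p = j :: p := by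
  cases h; assumption

theorem Valid.tail (h : Valid Special (j :: p)) : Valid Special p := by
  cases h; assumption

/-- The four ways in which a letter can act on a word. -/
theorem step_cases (j : Letter X) (p : List (Letter X)) :
    (∃ q, p = j :: q ∧ step Special j p = q) ∨
    (Special j ∧ p = [] ∧ step Special j p = base j) ∨
    (Special j ∧ p = base j ∧ step Special j p = []) ∨
    (p.head? ≠ some j ∧ step Special j p = j :: p) := by
  by_cases h : p.head? = some j
  · obtain ⟨q, rfl⟩ := List.head?_eq_some_iff.1 h
    exact .inl ⟨q, rfl, step_cons_self j q⟩
  by_cases h' : Special j ∧ (p = [] ∨ p = base j)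
  · obtain ⟨hj, rfl | rfl⟩ := h'
    · exact .inr (.inl ⟨hj, rfl, step_nil hj⟩)
    · exact .inr (.inr (.inl ⟨hj, rfl, step_base hj⟩))
  · exact .inr (.inr (.inr ⟨h, Letter.step_eq_cons h h'⟩))

theorem Valid.step (hp : Valid Special p) (j : Letter X) : Valid Special (step Special j p) := by
  rcases step_cases j p with ⟨q, rfl, h⟩ | ⟨hj, rfl, h⟩ | ⟨hj, rfl, h⟩ | ⟨-, h⟩
  · rw [h]; exact hp.tail
  · rw [h]; exact ((special_iff j).1 hj).2.1
  · rw [h]; exact .nil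
  · rw [h]; exact .cons hp h

theorem Valid.step_step (hp : Valid Special p) (j : Letter X) :
    Letter.step Special j (Letter.step Special j p) = p := by
  rcases step_cases j p with ⟨q, rfl, h⟩ | ⟨hj, rfl, h⟩ | ⟨hj, rfl, h⟩ | ⟨-, h⟩
  · rw [h]; exact hp.step_eq_cons
  · rw [h]; exact step_base hj
  · rw [h]; exact step_nil hj
  · rw [h]; exact step_cons_self j p

theorem step_ne (j : Letter X) (p : List (Letter X)) : Letter.step Special j p ≠ p := by
  rcases step_cases j p with ⟨q, rfl, h⟩ | ⟨hj, rfl, h⟩ | ⟨hj, rfl, h⟩ | ⟨-, h⟩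
  · rw [h]; exact (List.cons_ne_self j q).symm
  · rw [h]; exact ((special_iff j).1 hj).1
  · rw [h]; exact ((special_iff j).1 hj).1.symm
  · rw [h]; exact List.cons_ne_self j p

/-- Before a repeated letter the action would cancel instead of prepending. -/
theorem Valid.isChain (hp : Valid Special p) : p.IsChain (· ≠ ·) := by
  induction hp with
  | nil => exact .nil
  | @cons j p _ hs ih =>
    refine List.isChain_cons.2 ⟨?_, ih⟩
    rintro k hk rfl
    obtain ⟨q, rfl⟩ := List.head?_eq_some_iff.1 hk
    rw [step_cons_self] at hs
    have := congrArg List.length hs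
    simp at this
    omega

/-- The words in normal form. -/
def Point (X : Type u) : Type u := {p : List (Letter X) // Valid Special p}

-- The action on normal forms

namespace Point

/-- The empty word. -/
def nil : Point X := ⟨[], .nil⟩

/-- The involution of the set of normal forms that is given by a letter. -/
noncomputable def perm (j : Letter X) : Equiv.Perm (Point X) :=
  Function.Involutive.toPerm (fun p => ⟨step Special j p.1, p.2.step j⟩)
    fun p => Subtype.ext (p.2.step_step j)

theorem perm_val (j : Letter X) (p : Point X) : (perm j p).1 = step Special j p.1 := rfl

theorem perm_apply_ne (j : Letter X) (p : Point X) : perm j p ≠ p := fun h =>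
  step_ne j p.1 (congrArg Subtype.val h)

theorem perm_perm (j : Letter X) (p : Point X) : perm j (perm j p) = p :=
  Subtype.ext (p.2.step_step j)

theorem perm_mul_self (j : Letter X) : perm j * perm j = 1 :=
  Equiv.ext fun p => perm_perm j p

theorem perm_inv (j : Letter X) : (perm j)⁻¹ = perm j :=
  inv_eq_of_mul_eq_one_left (perm_mul_self j)

/-- The permutation of the set of normal forms that is given by a word. -/
noncomputable def act (w : List (Letter X)) : Equiv.Perm (Point X) := (w.map perm).prod

@[simp] theorem act_nil : act ([] : List (Letter X)) = 1 := rfl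

@[simp] theorem act_cons (j : Letter X) (w : List (Letter X)) : act (j :: w) = perm j * act w := by
  simp [act]

@[simp] theorem act_append (v w : List (Letter X)) : act (v ++ w) = act v * act w := by
  simp [act]

@[simp] theorem act_reverse (w : List (Letter X)) : act w.reverse = (act w)⁻¹ := by
  induction w with
  | nil => simp
  | cons j w ih => simp [ih, perm_inv]

theorem act_val (w : List (Letter X)) (p : Point X) : (act w p).1 = run Special w p.1 := by
  induction w with
  | nil => rfl
  | cons j w ih => simp [run, perm_val, ih]

/-- Every normal form can be exchanged with the empty word. -/
theorem exists_swap_nil (u : Point X) : ∃ w, act w nil = u ∧ act w u = nil := by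
  by_cases h0 : u = nil
  · exact ⟨[], by simp [h0]⟩
  have h0' : u.1 ≠ [] := fun h => h0 (Subtype.ext h)
  by_cases h : Special (link u.1)
  · refine ⟨[link u.1], Subtype.ext ?_, Subtype.ext ?_⟩
    · rw [act_cons, act_nil, mul_one, perm_val]
      exact step_nil h
    · rw [act_cons, act_nil, mul_one, perm_val]
      exact step_base h
  -- The base is valid and nonempty, so the letter can fail to be special only because smaller
  -- letters already make the exchange.
  · rw [special_iff] at h
    by_contra h'
    refine h ⟨h0', u.2, ?_⟩
    rintro ⟨w, -, h1, h2⟩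
    exact h' ⟨w, Subtype.ext ((act_val w nil).trans h1), Subtype.ext ((act_val w u).trans h2)⟩

-- Fixed points of reduced words

/-- A reduced word acts by concatenation, provided that the normal form contains an upper bound of
its letters. -/
theorem act_val_eq_append {n : Letter X} {p : Point X} (hn : n ∈ p.1) :
    ∀ {w : List (Letter X)}, (∀ j ∈ w, j ≤ n) → (w ++ p.1).IsChain (· ≠ ·) →
      (act w p).1 = w ++ p.1
  | [], _, _ => rfl
  | j :: w, hw, hc => by
    have hc' : (w ++ p.1).IsChain (· ≠ ·) := hc.tail
    have ih := act_val_eq_append hn (fun k hk => hw k (List.mem_cons_of_mem _ hk)) hc'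
    rw [act_cons, Equiv.Perm.mul_apply, perm_val, ih, List.cons_append]
    refine step_eq_cons ?_ ?_
    · intro h
      exact (List.isChain_cons.1 hc).1 j h rfl
    -- The exceptional words `[]` and `base j` contain no letter that is at least `j`, whereas this
    -- word contains `n ≥ j`.
    · have hm : n ∈ w ++ p.1 := List.mem_append_right _ hn
      rintro ⟨-, h | h⟩
      · rw [h] at hm
        simp at hm
      · rw [h] at hm
        exact absurd (lt_of_mem_base hm) (not_lt.2 (hw j List.mem_cons_self))

/-- A closed path that is cyclically reduced passes through its largest letter only along the edge
between the empty word and the base of that letter; here the path starts with that edge. -/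
theorem eq_nil_or_base_of_closed {n : Letter X} {w : List (Letter X)} {p : Point X}
    (hw : ∀ j ∈ w, j ≤ n) (hc : (n :: w ++ [n]).IsChain (· ≠ ·)) (hp : act (w ++ [n]) p = p) :
    Special n ∧ (p.1 = [] ∨ p.1 = base n) := by
  simp only [act_append, act_cons, act_nil, mul_one, Equiv.Perm.mul_apply] at hp
  rcases step_cases n p.1 with ⟨q, hq, h⟩ | ⟨hj, h, -⟩ | ⟨hj, h, -⟩ | ⟨-, h⟩
  -- Here `p` starts with `n`. Traversed backwards, the rest of the path only lengthens `p` and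
  -- cannot end at its tail.
  · have h1 : act w.reverse p = perm n p := by
      rw [act_reverse, Equiv.Perm.inv_eq_iff_eq]
      exact hp.symm
    have h2 : (w.reverse ++ p.1).IsChain (· ≠ ·) := by
      have h3 : (w.reverse ++ [n]).IsChain (· ≠ ·) := by
        have : (n :: w).IsChain (· ≠ ·) := hc.left_of_append
        rw [← List.isChain_reverse] at this
        simpa [ne_comm] using this
      have h4 := p.2.isChain
      rw [hq] at h4 ⊢
      exact List.isChain_split.2 ⟨h3, h4⟩
    have h5 := act_val_eq_append (by rw [hq]; exact List.mem_cons_self)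
      (fun j hj => hw j (List.mem_reverse.1 hj)) h2
    rw [h1, perm_val, h, hq] at h5
    have := congrArg List.length h5
    simp at this
    omega
  · exact ⟨hj, .inl h⟩
  · exact ⟨hj, .inr h⟩
  -- Here `n` is prepended, and the rest of the path only lengthens the word further.
  · have h1 : (perm n p).1 = n :: p.1 := h
    have h2 : (w ++ (perm n p).1).IsChain (· ≠ ·) := by
      have h3 : (w ++ [n]).IsChain (· ≠ ·) := hc.tail
      have h4 := (perm n p).2.isChain
      rw [h1] at h4 ⊢
      exact List.isChain_split.2 ⟨h3, h4⟩
    have h5 := act_val_eq_append (by rw [h1]; exact List.mem_cons_self) hw h2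
    rw [hp, h1] at h5
    have := congrArg List.length h5
    simp at this
    omega

/-- A word is cyclically reduced if its square is reduced. -/
def CycRed (g : List (Letter X)) : Prop := (g ++ g).IsChain (· ≠ ·)

/-- Rotating the closed path makes it start at the given occurrence of `n`; the rotated word is
reduced because `n b a n` occurs in the square of `a n b`. -/
theorem eq_nil_or_base_of_cycRed {n : Letter X} {a b : List (Letter X)} {p : Point X}
    (hc : CycRed (a ++ n :: b)) (hn : ∀ j ∈ a ++ n :: b, j ≤ n) (hp : act (a ++ n :: b) p = p) :
    Special n ∧ ((act b p).1 = [] ∨ (act b p).1 = base n) := by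
  refine eq_nil_or_base_of_closed (w := b ++ a) ?_ ?_ ?_
  · intro j hj
    refine hn j ?_
    simp only [List.mem_append, List.mem_cons] at hj ⊢
    tauto
  · refine List.IsChain.infix hc ⟨a, b, ?_⟩
    simp
  · simp only [act_append, act_cons, act_nil, mul_one, Equiv.Perm.mul_apply] at hp ⊢
    rw [hp]

/-- Up to conjugation, a reduced word is a letter or cyclically reduced. -/
theorem exists_conj {g : List (Letter X)} (hg : g ≠ []) (hc : g.IsChain (· ≠ ·)) :
    ∃ c g' : List (Letter X), act g = act c * act g' * (act c)⁻¹ ∧ (∀ j ∈ g', j ∈ g) ∧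
      g'.length % 2 = g.length % 2 ∧ ((∃ i, g' = [i]) ∨ (g' ≠ [] ∧ CycRed g')) := by
  induction hl : g.length using Nat.strong_induction_on generalizing g with
  | _ l ih =>
    subst hl
    by_cases h : CycRed g
    · exact ⟨[], g, by simp, fun _ h => h, rfl, .inr ⟨hg, h⟩⟩
    obtain ⟨a, b, hab⟩ : ∃ a b, g = a :: b := List.exists_cons_of_ne_nil hg
    rcases List.eq_nil_or_concat' b with rfl | ⟨b, z, rfl⟩
    · exact ⟨[], g, by simp, fun _ h => h, rfl, .inl ⟨a, hab⟩⟩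
    subst hab
    have haz : z = a := by
      by_contra haz
      refine h ?_
      rw [CycRed, List.isChain_append]
      refine ⟨hc, hc, ?_⟩
      rw [← List.cons_append, List.getLast?_concat]
      simp [haz]
    subst haz
    have hb : b ≠ [] := by
      rintro rfl
      simp at hc
    have hbc : b.IsChain (· ≠ ·) := List.IsChain.infix hc ⟨[z], [z], by simp⟩
    obtain ⟨c, g', h1, h2, h3, h4⟩ := ih b.length (by simp) hb hbc rfl
    refine ⟨z :: c, g', ?_, ?_, ?_, h4⟩
    · simp [h1, perm_inv, mul_assoc]
    · intro j hj
      simp [h2 j hj]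
    · rw [h3]
      simp
      omega

theorem conj_apply_eq {G : Equiv.Perm (Point X)} {c : Equiv.Perm (Point X)} {p : Point X}
    (h : (c * G * c⁻¹) p = p) : G (c⁻¹ p) = c⁻¹ p := by
  rw [Equiv.Perm.eq_inv_iff_eq]
  exact h

/-- Induction on the largest letter `n`. Both closed paths cross `n` only between the empty word and
`base n`. A stretch between consecutive crossings uses smaller letters and permutes these two
points. Fixing both contradicts induction, exchanging them contradicts the greedy choice. -/
theorem not_two_fixed_of_cycRed (n : Letter X) {g : List (Letter X)} (hc : CycRed g) (hn : n ∈ g)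
    (hg : ∀ j ∈ g, j ≤ n) {p q : Point X} (hpq : p ≠ q) (hp : act g p = p) (hq : act g q = q) :
    False := by
  induction n using WellFoundedLT.induction generalizing g p q with
  | _ n ih =>
    -- Words act from the right, so when the path is repeated, the leftmost `n` is followed by `c`,
    -- then by `b`, and then by the rightmost `n`. The stretch in question is thus `b ++ c`.
    obtain ⟨c, d, hcd, hnc⟩ : ∃ c d, g = c ++ n :: d ∧ n ∉ c := by
      obtain ⟨c, d, h, hc⟩ := List.eq_append_cons_of_mem hn
      exact ⟨c, d, h, hc⟩
    obtain ⟨a, b, hab, hnb⟩ : ∃ a b, g = a ++ n :: b ∧ n ∉ b := by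
      obtain ⟨c, d, h, hc⟩ := List.eq_append_cons_of_mem (List.mem_reverse.2 hn)
      exact ⟨d.reverse, c.reverse, by rw [← List.reverse_reverse g, h]; simp, by simpa using hc⟩
    have key : ∀ r : Point X, act g r = r → Special n ∧
        ((perm n (act d r)).1 = [] ∨ (perm n (act d r)).1 = base n) ∧
        ((act (b ++ c) (perm n (act d r))).1 = [] ∨
          (act (b ++ c) (perm n (act d r))).1 = base n) := by
      intro r hr
      have h1 := eq_nil_or_base_of_cycRed (hcd ▸ hc) (hcd ▸ hg) (hcd ▸ hr)
      have h2 := eq_nil_or_base_of_cycRed (hab ▸ hc) (hab ▸ hg) (hab ▸ hr)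
      refine ⟨h1.1, ?_, ?_⟩
      · rw [perm_val]
        rcases h1.2 with h | h
        · exact .inr (by rw [h, step_nil h1.1])
        · exact .inl (by rw [h, step_base h1.1])
      · have h3 : act (b ++ c) (perm n (act d r)) = act b r := by
          rw [hcd] at hr
          simp only [act_append, act_cons, Equiv.Perm.mul_apply] at hr ⊢
          rw [hr]
        rw [h3]
        exact h2.2
    have hgg : g ++ g = a ++ n :: (b ++ c ++ n :: d) :=
      (congrArg₂ (· ++ ·) hab hcd).trans (by simp)
    have hv' : (n :: (b ++ c ++ n :: d)).IsChain (· ≠ ·) :=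
      List.IsChain.right_of_append (hgg ▸ hc : (a ++ n :: (b ++ c ++ n :: d)).IsChain (· ≠ ·))
    have hv : (b ++ c).IsChain (· ≠ ·) := hv'.tail.left_of_append
    have hv0 : b ++ c ≠ [] := by
      intro h0
      rw [h0] at hv'
      simp at hv'
    have hvn : ∀ j ∈ b ++ c, j < n := by
      intro j hj
      refine lt_of_le_of_ne (hg j ?_) ?_
      · rcases List.mem_append.1 hj with h | h
        · rw [hab]; simp [h]
        · rw [hcd]; simp [h]
      · rintro rfl
        rcases List.mem_append.1 hj with h | h
        · exact hnb h
        · exact hnc h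
    -- `b ++ c` need not be cyclically reduced; conjugation makes it so, or makes it a single
    -- letter, without introducing new letters.
    have low : ∀ r s : Point X, r ≠ s → act (b ++ c) r = r → act (b ++ c) s = s → False := by
      intro r s hrs hr hs
      obtain ⟨e, g', h1, h2, -, h4⟩ := exists_conj hv0 hv
      rw [h1] at hr hs
      have hr' := conj_apply_eq hr
      have hs' := conj_apply_eq hs
      rcases h4 with ⟨i, rfl⟩ | ⟨h0, h4⟩
      · simp only [act_cons, act_nil, mul_one] at hr'
        exact perm_apply_ne _ _ hr'
      · have hne : g'.toFinset.Nonempty := by simpa using h0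
        have hm := g'.toFinset.max'_mem hne
        rw [List.mem_toFinset] at hm
        exact ih _ (hvn _ (h2 _ hm)) h4 hm
          (fun j hj => g'.toFinset.le_max' j (List.mem_toFinset.2 hj))
          (fun h => hrs ((act e)⁻¹.injective h)) hr' hs'
    obtain ⟨hn', hp1, hp2⟩ := key p hp
    obtain ⟨-, hq1, hq2⟩ := key q hq
    have hB := (special_iff n).1 hn'
    have hpq' : perm n (act d p) ≠ perm n (act d q) := fun h =>
      hpq ((act d).injective ((perm n).injective h))
    have hpq'' := (act (b ++ c)).injective.ne hpq'
    generalize perm n (act d p) = p' at *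
    generalize perm n (act d q) = q' at *
    have hlink : ∀ r s : Point X, r.1 = [] → s.1 = base n → act (b ++ c) r = s →
        act (b ++ c) s = r → False := by
      intro r s hr hs h1 h2
      refine hB.2.2 ⟨b ++ c, hvn, ?_, ?_⟩
      · rw [← hr, ← act_val, h1, hs]
      · rw [← hs, ← act_val, h2, hr]
    have e : ∀ {r s : Point X} {l : List (Letter X)}, r.1 = l → s.1 = l → r = s :=
      fun h h' => Subtype.ext (h.trans h'.symm)
    rcases hp1 with hp1 | hp1 <;> rcases hq1 with hq1 | hq1 <;>
      rcases hp2 with hp2 | hp2 <;> rcases hq2 with hq2 | hq2 <;>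
      first
      | exact hpq' (e hp1 hq1)
      | exact hpq'' (e hp2 hq2)
      | exact low p' q' hpq' (e hp2 hp1) (e hq2 hq1)
      | exact hlink p' q' hp1 hq1 (e hp2 hq1) (e hq2 hp1)
      | exact hlink q' p' hq1 hp1 (e hq2 hp1) (e hp2 hq1)

/-- A nonempty reduced word has at most one fixed point. -/
theorem not_two_fixed {g : List (Letter X)} (hg : g ≠ []) (hc : g.IsChain (· ≠ ·))
    {p q : Point X} (hpq : p ≠ q) (hp : act g p = p) (hq : act g q = q) : False := by
  obtain ⟨e, g', h1, -, -, h4⟩ := exists_conj hg hc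
  rw [h1] at hp hq
  have hp' := conj_apply_eq hp
  have hq' := conj_apply_eq hq
  rcases h4 with ⟨i, rfl⟩ | ⟨h0, h4⟩
  · simp only [act_cons, act_nil, mul_one] at hp'
    exact perm_apply_ne _ _ hp'
  · have hne : g'.toFinset.Nonempty := by simpa using h0
    have hm := g'.toFinset.max'_mem hne
    rw [List.mem_toFinset] at hm
    exact not_two_fixed_of_cycRed _ h4 hm
      (fun j hj => g'.toFinset.le_max' j (List.mem_toFinset.2 hj))
      (fun h => hpq ((act e)⁻¹.injective h)) hp' hq'

theorem exists_reduced (g : List (Letter X)) : ∃ g' : List (Letter X), act g = act g' ∧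
    g'.length % 2 = g.length % 2 ∧ g'.IsChain (· ≠ ·) := by
  induction g with
  | nil => exact ⟨[], rfl, rfl, .nil⟩
  | cons j g ih =>
    obtain ⟨g', h1, h2, h3⟩ := ih
    by_cases h : g'.head? = some j
    · obtain ⟨t, rfl⟩ := List.head?_eq_some_iff.1 h
      refine ⟨t, ?_, ?_, h3.tail⟩
      · rw [act_cons, h1, act_cons, ← mul_assoc, perm_mul_self, one_mul]
      · simp only [List.length_cons] at h2 ⊢
        omega
    · refine ⟨j :: g', by rw [act_cons, h1, act_cons], ?_, List.isChain_cons.2 ⟨?_, h3⟩⟩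
      · simp only [List.length_cons]
        omega
      · rintro y hy rfl
        exact h hy

/-- A word that fixes two normal forms acts trivially. -/
theorem act_eq_one_of_two_fixed {g : List (Letter X)} {p q : Point X} (hpq : p ≠ q)
    (hp : act g p = p) (hq : act g q = q) : act g = 1 := by
  obtain ⟨g', h1, -, h3⟩ := exists_reduced g
  rw [h1] at hp hq ⊢
  by_cases h : g' = []
  · rw [h, act_nil]
  · exact (not_two_fixed h h3 hpq hp hq).elim

-- Elements of order at most two

/-- A word of order at most two is trivial or a conjugate of a letter. -/
theorem eq_one_or_conj {g : List (Letter X)} (hg : act g * act g = 1) :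
    act g = 1 ∨ g.length % 2 = 1 ∧ ∃ c i, act g = act c * perm i * (act c)⁻¹ := by
  obtain ⟨g', h1, h2, h3⟩ := exists_reduced g
  by_cases h : g' = []
  · left
    rw [h1, h, act_nil]
  right
  obtain ⟨c, k, h4, -, h5, h6⟩ := exists_conj h h3
  rcases h6 with ⟨i, rfl⟩ | ⟨h0, h6⟩
  · refine ⟨by rw [← h2, ← h5]; rfl, c, i, ?_⟩
    rw [h1, h4]
    simp
  · exfalso
    have hk : act k * act k = 1 := by
      have : act k = (act c)⁻¹ * act g * act c := by rw [h1, h4]; group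
      rw [this]
      calc _ = (act c)⁻¹ * (act g * act g) * act c := by group
        _ = 1 := by rw [hg]; group
    have hk' : act (k ++ k) = 1 := by rw [act_append, hk]
    obtain ⟨j, -⟩ := List.exists_mem_of_ne_nil k h0
    -- The square of `k` is reduced and nonempty but acts trivially, so it fixes two distinct
    -- points.
    exact not_two_fixed (g := k ++ k) (by simpa using h0) h6 (perm_apply_ne j nil)
      (by rw [hk']; rfl) (by rw [hk']; rfl)

/-- A word of order at most two that fixes a normal form acts trivially. -/
theorem act_eq_one_of_fixed {g : List (Letter X)} (hg : act g * act g = 1) {p : Point X}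
    (hp : act g p = p) : act g = 1 := by
  rcases eq_one_or_conj hg with h | ⟨-, c, i, h⟩
  · exact h
  · rw [h] at hp
    exact (perm_apply_ne _ _ (conj_apply_eq hp)).elim

/-- Words of order at most two are determined by the image of one normal form. -/
theorem act_eq_act {v w : List (Letter X)} (hv : act v * act v = 1) (hw : act w * act w = 1)
    {p : Point X} (h : act v p = act w p) : act v = act w := by
  by_cases hp : act v p = p
  · rw [act_eq_one_of_fixed hv hp, act_eq_one_of_fixed hw (h ▸ hp)]
  · have hv' : ∀ q, act v (act v q) = q := fun q => Equiv.ext_iff.1 hv q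
    have hw' : ∀ q, act w (act w q) = q := fun q => Equiv.ext_iff.1 hw q
    have h1 : act (v ++ w) = 1 := by
      refine act_eq_one_of_two_fixed hp ?_ ?_
      · rw [act_append, Equiv.Perm.mul_apply, h, hw', ← h]
      · rw [act_append, Equiv.Perm.mul_apply, ← h, hv']
    rw [act_append] at h1
    rw [eq_inv_of_mul_eq_one_left h1, inv_eq_of_mul_eq_one_left hw]

/-- The square of a word that exchanges two distinct points fixes both, hence is trivial. -/
theorem exists_involution (q : Point X) : ∃ w, act w * act w = 1 ∧ act w nil = q := by
  obtain ⟨w, h1, h2⟩ := exists_swap_nil q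
  by_cases hq : q = nil
  · exact ⟨[], by simp [hq]⟩
  · refine ⟨w, ?_, h1⟩
    rw [← act_append]
    refine act_eq_one_of_two_fixed hq ?_ ?_ <;> simp [h1, h2]

/-- The word of order at most two that moves the empty word to a given normal form. -/
noncomputable def word (q : Point X) : List (Letter X) := (exists_involution q).choose

theorem word_mul_self (q : Point X) : act (word q) * act (word q) = 1 :=
  (exists_involution q).choose_spec.1

theorem word_nil (q : Point X) : act (word q) nil = q := (exists_involution q).choose_spec.2

theorem act_eq_word {w : List (Letter X)} (hw : act w * act w = 1) {q : Point X}
    (h : act w nil = q) : act w = act (word q) :=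
  act_eq_act hw (word_mul_self q) (h.trans (word_nil q).symm)

-- The Bol loop of normal forms

noncomputable instance instMulOneClass : MulOneClass (Point X) where
  one := nil
  mul p q := act (word q) p
  one_mul q := word_nil q
  mul_one p := by
    change act (word nil) p = p
    rw [← act_eq_word (w := []) (q := nil) (by simp) rfl]
    rfl

theorem mul_def (p q : Point X) : p * q = act (word q) p := rfl

/-- The right side has order at most two and moves the empty word to `(q * r) * q`, so uniqueness
applies. -/
theorem act_word_mul_mul (q r : Point X) :
    act (word ((q * r) * q)) = act (word q) * act (word r) * act (word q) := by
  have h := act_eq_word (w := word q ++ word r ++ word q) (q := (q * r) * q) ?_ ?_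
  · rw [← h]
    simp [mul_assoc]
  · simp only [act_append]
    calc _ = act (word q) * act (word r) * (act (word q) * act (word q)) * act (word r) *
          act (word q) := by group
      _ = act (word q) * (act (word r) * act (word r)) * act (word q) := by
        rw [word_mul_self q]; group
      _ = 1 := by rw [word_mul_self, mul_one, word_mul_self]
  · simp only [act_append, Equiv.Perm.mul_apply, word_nil]
    rfl

theorem mul_self (p : Point X) : p * p = 1 := by
  have h := Equiv.ext_iff.1 (word_mul_self p) nil
  rw [Equiv.Perm.mul_apply, word_nil] at h
  exact h

theorem mul_mul_self (p q : Point X) : (p * q) * q = p := Equiv.ext_iff.1 (word_mul_self q) p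

theorem bol (p q r : Point X) : p * ((q * r) * q) = ((p * q) * r) * q := by
  rw [mul_def p, act_word_mul_mul]
  rfl

noncomputable instance instLoop : Loop (Point X) where
  existsUnique_left a b := by
    refine ⟨(a * (b * a)) * a, ?_, ?_⟩
    · change a * ((a * (b * a)) * a) = b
      rw [bol, mul_self, one_mul, mul_mul_self]
    · rintro y rfl
      rw [bol, mul_self, one_mul, mul_mul_self]
  existsUnique_right a b := by
    refine ⟨b * a, mul_mul_self b a, ?_⟩
    rintro y rfl
    exact (mul_mul_self y a).symm

/-- In the loop of normal forms, `z = x * (x * z)` has only trivial solutions. -/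
theorem eq_of_eq_mul_mul {x z : Point X} (hx : x ≠ 1) (hz : z ≠ 1) (h : z = x * (x * z)) :
    x = z := by
  obtain ⟨w, hw⟩ : ∃ w, w = x * z := ⟨_, rfl⟩
  have hwz : w * z = x := by rw [hw, mul_mul_self]
  have hzw : (w * z) * w = z := by rw [hwz, hw, ← h]
  have h1 : act (word z) = act (word w) * act (word z) * act (word w) := by
    rw [← act_word_mul_mul, hzw]
  have h2 : act (word z ++ word w) * act (word z ++ word w) = 1 := by
    rw [act_append]
    calc _ = act (word z) * (act (word w) * act (word z) * act (word w)) := by group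
      _ = 1 := by rw [← h1, word_mul_self]
  have trivial_word : ∀ q : Point X, act (word q) = 1 → q = 1 := fun q hq => by
    rw [← word_nil q, hq]
    rfl
  rcases eq_one_or_conj (word_mul_self z) with h3 | ⟨h3, -⟩
  · exact (hz (trivial_word z h3)).elim
  rcases eq_one_or_conj (word_mul_self w) with h4 | ⟨h4, -⟩
  · rw [← hwz, trivial_word w h4, one_mul]
  rcases eq_one_or_conj h2 with h5 | ⟨h5, -⟩
  -- A nontrivial product would have odd length, but both factors have odd length.
  · rw [act_append] at h5
    have h6 : act (word z) = act (word w) := by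
      rw [eq_inv_of_mul_eq_one_left h5, inv_eq_of_mul_eq_one_left (word_mul_self w)]
    have h7 : z = w := by rw [← word_nil z, h6, word_nil]
    refine (hx ?_).elim
    rw [← hwz, ← h7, mul_self]
  · rw [List.length_append] at h5
    omega

end Point

-- Evaluation in an arbitrary Bol loop of exponent two

section Eval

variable {B : Type u} [Loop B] (f : X → B)

mutual
/-- The value of a letter in a loop. -/
def eval : Letter X → B
  | gen x => f x
  | link u => evalWord u
/-- The value of a word in a loop. -/
def evalWord : List (Letter X) → B
  | [] => 1
  | j :: p => evalWord p * eval j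
end

theorem mul_mul_self_of_isBol (hb : IsBol B) (he : HasExponentTwo B) (x y : B) :
    (x * y) * y = x := by
  have h := hb x y 1
  rw [mul_one, mul_one, he, mul_one] at h
  exact h.symm

variable {f} (hb : IsBol B) (he : HasExponentTwo B)
include hb he

theorem evalWord_step (j : Letter X) (p : List (Letter X)) :
    evalWord f (step Special j p) = evalWord f p * eval f j := by
  have hbase : Special j → eval f j = evalWord f (base j) := fun hj => by
    cases j with
    | gen x => exact (((special_iff _).1 hj).1 rfl).elim
    | link u => simp only [eval, base]
  rcases step_cases j p with ⟨q, rfl, h⟩ | ⟨hj, rfl, h⟩ | ⟨hj, rfl, h⟩ | ⟨-, h⟩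
  · rw [h, evalWord, mul_mul_self_of_isBol hb he]
  · rw [h, evalWord, one_mul, hbase hj]
  · rw [h, evalWord, hbase hj, he]
  · rw [h, evalWord]

/-- By the Bol identity, conjugating one right translation by another again gives a right
translation. -/
theorem exists_evalWord_conj (c : List (Letter X)) (y : B) : ∃ z : B, ∀ p : Point X, ∀ G,
    (∀ p : Point X, evalWord f (G p).1 = evalWord f p.1 * y) →
      evalWord f ((Point.act c * G * (Point.act c)⁻¹ : Equiv.Perm (Point X)) p).1 =
        evalWord f p.1 * z := by
  induction c generalizing y with
  | nil => exact ⟨y, fun p G hG => by simpa using hG p⟩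
  | cons j c ih =>
    obtain ⟨z, hz⟩ := ih y
    refine ⟨(eval f j * z) * eval f j, fun p G hG => ?_⟩
    have : (Point.act (j :: c) * G * (Point.act (j :: c))⁻¹ : Equiv.Perm (Point X)) p =
        Point.perm j ((Point.act c * G * (Point.act c)⁻¹ : Equiv.Perm (Point X))
          (Point.perm j p)) := by
      simp [Point.perm_inv]
    rw [this, Point.perm_val, evalWord_step hb he, hz _ G hG, Point.perm_val,
      evalWord_step hb he, hb]

theorem evalWord_mul (p q : Point X) :
    evalWord f (p * q).1 = evalWord f p.1 * evalWord f q.1 := by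
  have key : ∃ z : B, ∀ p : Point X, evalWord f (p * q).1 = evalWord f p.1 * z := by
    rcases Point.eq_one_or_conj (Point.word_mul_self q) with h | ⟨-, c, i, h⟩
    · refine ⟨1, fun p => ?_⟩
      rw [Point.mul_def, h, mul_one]
      rfl
    · obtain ⟨z, hz⟩ := exists_evalWord_conj (f := f) hb he c (eval f i)
      refine ⟨z, fun p => ?_⟩
      rw [Point.mul_def, h]
      exact hz p _ fun p => evalWord_step hb he i p.1
  obtain ⟨z, hz⟩ := key
  -- Evaluating at the identity identifies `z` as the value of `q`.
  have h1 := hz 1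
  have h2 : evalWord f (1 : Point X).1 = 1 := by
    change evalWord f [] = 1
    rw [evalWord]
  rw [one_mul, h2, one_mul] at h1
  rw [hz, h1]

/-- The homomorphism from the loop of normal forms that is given by evaluation. -/
def evalHom : Point X →* B where
  toFun p := evalWord f p.1
  map_one' := by
    change evalWord f [] = 1
    rw [evalWord]
  map_mul' := evalWord_mul hb he

theorem exists_evalHom_eq (x : X) : ∃ p : Point X, evalHom (f := f) hb he p = f x := by
  refine ⟨Point.perm (gen x) Point.nil, ?_⟩
  change evalWord f (step Special (gen x) []) = f x
  rw [evalWord_step hb he, evalWord, one_mul, eval]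

end Eval

end Letter

-- Transfer to free loops

theorem IsFreeBolLoopTwo.eq_of_eq_mul_mul {B : Type u} [Loop B] {X : Set B}
    (hX : IsFreeBolLoopTwo X) {x z : B} (hx : x ≠ 1) (hz : z ≠ 1) (h : z = x * (x * z)) :
    x = z := by
  let π : Letter.Point X →* B :=
    Letter.evalHom (f := ((↑) : X → B)) hX.isBol hX.hasExponentTwo
  choose g hg using Letter.exists_evalHom_eq (f := ((↑) : X → B)) hX.isBol hX.hasExponentTwo
  obtain ⟨s, hs⟩ := hX.exists_extension (Letter.Point X) Letter.Point.bol Letter.Point.mul_self g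
  -- The elements fixed by `π ∘ s` form a subloop containing the generators, so `s` is injective.
  have hS : {b : B | π (s b) = b} = Set.univ := by
    refine hX.generates _ ⟨?_, ?_, ?_, ?_⟩ ?_
    · simp
    · intro a ha b hb
      simp only [Set.mem_ofPred_eq, map_mul] at ha hb ⊢
      rw [ha, hb]
    · intro a ha b hb
      simp only [Set.mem_ofPred_eq, map_mul] at ha hb ⊢
      rw [ha] at hb
      exact (existsUnique_left a (a * b)).unique hb rfl
    · intro a ha b hb
      simp only [Set.mem_ofPred_eq, map_mul] at ha hb ⊢
      rw [ha] at hb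
      exact (existsUnique_right a (b * a)).unique hb rfl
    · intro b hb
      change π (s b) = b
      rw [hs ⟨b, hb⟩]
      exact hg ⟨b, hb⟩
  have hπ : Function.LeftInverse π s := fun b => by
    have : b ∈ {b : B | π (s b) = b} := hS ▸ Set.mem_univ b
    exact this
  have hne : ∀ b, b ≠ 1 → s b ≠ 1 := fun b hb h => hb (hπ.injective (h.trans (map_one s).symm))
  refine hπ.injective (Letter.Point.eq_of_eq_mul_mul (hne x hx) (hne z hz) ?_)
  rw [← map_mul, ← map_mul, ← h]

/-- In a free Bol loop of exponent two the identity element is not a generator. -/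
theorem IsFreeBolLoopTwo.one_notMem {B : Type u} [Loop B] {X : Set B}
    (hX : IsFreeBolLoopTwo X) : (1 : B) ∉ X := by
  intro h
  -- Any nontrivial target value would do; a product of two distinct generators is nontrivial
  -- because `(ab)b = a`.
  obtain ⟨φ, hφ⟩ := hX.exists_extension (FreeBolTwo (ULift Bool)) FreeBolTwo.bol
    FreeBolTwo.mul_self fun _ => FreeBolTwo.of ⟨true⟩ * FreeBolTwo.of ⟨false⟩
  have h1 := hφ ⟨1, h⟩
  rw [map_one] at h1
  have h2 := congrArg (· * FreeBolTwo.of ⟨false⟩) h1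
  simp only [one_mul, FreeBolTwo.mul_mul_self] at h2
  have h3 := congrArg ULift.down (FreeBolTwo.of_injective _ h2)
  simp at h3

/-- If a nontrivial element of a free Bol loop of exponent two is equal to all other nontrivial
elements, then there is exactly one generator. -/
theorem IsFreeBolLoopTwo.encard_eq_one {B : Type u} [Loop B] {X : Set B}
    (hX : IsFreeBolLoopTwo X) {a : B} (ha : a ≠ 1) (h : ∀ b : B, b ≠ 1 → b = a) :
    X.encard = 1 := by
  rw [Set.encard_eq_one]
  refine ⟨a, Set.Subset.antisymm (fun b hb => ?_) ?_⟩
  · exact h b fun h1 => hX.one_notMem (h1 ▸ hb)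
  · rw [Set.singleton_subset_iff]
    by_contra haX
    -- Every generator is nontrivial and so would equal `a`; without generators the loop is trivial.
    have hXe : X = ∅ := Set.eq_empty_of_forall_notMem fun b hb =>
      haX (h b (fun h1 => hX.one_notMem (h1 ▸ hb)) ▸ hb)
    have h1 : ({1} : Set B) = Set.univ := by
      refine hX.generates {1} ⟨rfl, ?_, ?_, ?_⟩ (by simp [hXe])
      · rintro _ rfl _ rfl
        simp
      · rintro _ rfl b hb
        simpa using hb
      · rintro _ rfl b hb
        simpa using hb
    exact ha (h1.symm ▸ Set.mem_univ a : a ∈ ({1} : Set B))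

end Loop

theorem corollary5p2 {B : Type u} [Loop B] (X : Set B) (hX : Loop.IsFreeBolLoopTwo X) :
    (∀ x z : B, x ≠ 1 → z ≠ 1 → (z = x * (x * z) ↔ x = z)) ∧
    (X.encard ≠ 1 →
      Loop.leftNucleus B = {1} ∧ Loop.middleNucleus B = {1} ∧ Loop.rightNucleus B = {1} ∧
      Loop.nucleus B = {1} ∧ Loop.center B = {1}) := by
  refine ⟨fun x z hx hz => ⟨hX.eq_of_eq_mul_mul hx hz, ?_⟩, fun hcard => ?_⟩
  · rintro rfl
    rw [hX.hasExponentTwo, mul_one]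
  have h1 : Loop.leftNucleus B = {1} := by
    refine Set.Subset.antisymm (fun a ha => ?_) (by rintro _ rfl; simp [Loop.leftNucleus])
    by_contra hne
    refine hcard (hX.encard_eq_one hne fun b hb => (hX.eq_of_eq_mul_mul hne hb ?_).symm)
    rw [ha, hX.hasExponentTwo, one_mul]
  have h2 : Loop.middleNucleus B = {1} := by
    refine Set.Subset.antisymm (fun a ha => ?_) (by rintro _ rfl; simp [Loop.middleNucleus])
    by_contra hne
    refine hcard (hX.encard_eq_one hne fun b hb => (hX.eq_of_eq_mul_mul hne hb ?_).symm)
    rw [ha, hX.hasExponentTwo, one_mul]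
  have h3 : Loop.rightNucleus B = {1} := by
    refine Set.Subset.antisymm (fun a ha => ?_) (by rintro _ rfl; simp [Loop.rightNucleus])
    by_contra hne
    refine hcard (hX.encard_eq_one hne fun b hb => hX.eq_of_eq_mul_mul hb hne ?_)
    rw [ha, hX.hasExponentTwo, one_mul]
  have h4 : Loop.nucleus B = {1} := by simp [Loop.nucleus, h1, h2, h3]
  refine ⟨h1, h2, h3, h4, ?_⟩
  ext a
  simp only [Loop.center, h4, Set.mem_ofPred_eq, Set.mem_singleton_iff]
  constructor
  · exact fun h => h.1
  · rintro rfl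
    simp
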